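/- Standing conventions. Let $\mathbb A$ be a nonzero finite-dimensional real alternative (not necessarily associative) algebra with unity, endowed with an anti-involution $\alpha\mapsto\alpha^c$ (real linear, $(\alpha^c)^c=\alpha$, $(\alpha\beta)^c=\beta^c\alpha^c$). Its quadratic cone $Q_{\mathbb A}$ consists of the real numbers (identified with $\mathbb R\cdot 1$) and of all $\alpha\in\mathbb A$ such that $t(\alpha)=\alpha+\alpha^c$ and $n(\alpha)=\alpha\alpha^c$ are real and $t(\alpha)^2-4n(\alpha)<0$. Assume that some $j\in Q_{\mathbb A}$ satisfies $j^2=-1$ and that $\mathbb A$ carries a real vector space norm $|\cdot|$ with $|\alpha|=\sqrt{n(\alpha)}$ for $\alpha\in Q_{\mathbb A}$. Let $X$ be a Banach $\mathbb A$-bimodule: an abelian group with biadditive left and right multiplications by elements of $\mathbb A$ whose restrictions to $\mathbb R$ coincide and make $X$ a real vector space (and, only if $\mathbb A$ is associative, satisfying $\alpha(\beta x)=(\alpha\beta)x$, $(x\alpha)\beta=x(\alpha\beta)$, $\alpha(x\beta)=(\alpha x)\beta$), with a complete norm such that $\|\alpha x\|\le|\alpha|\|x\|$ and $\|x\alpha\|\le|\alpha|\|x\|$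 for $\alpha\in\mathbb A$, with equalities for $\alpha\in Q_{\mathbb A}$. An operator $A:D(A)\to X$ is right linear if $D(A)$ is a right $\mathbb A$-submodule, $A$ is additive and $A(x\alpha)=A(x)\alpha$; $\mathcal L^r(X)$ is the set of bounded right linear operators defined on all of $X$, with the operator norm. For a closed right linear $A$ and $\alpha\in Q_{\mathbb A}$ put $\Delta_\alpha(A)=A^2-2\,\mathrm{Re}(\alpha)A+|\alpha|^2\,\mathrm{Id}$ on $D(A^2)=\{x\in D(A): Ax\in D(A)\}$, where $\mathrm{Re}(\alpha)=(\alpha+\alpha^c)/2\in\mathbb R$. The spherical resolvent set $\rho_s(A)$ is the set of $\alpha\in Q_{\mathbb A}$ for which $\Delta_\alpha(A):D(A^2)\to X$ is bijective with $Q_\alpha(A):=\Delta_\alpha(A)^{-1}\in\mathcal L^r(X)$, and for such $\alpha$ the spherical resolvent operator is $C_\alpha(A)x=Q_\alpha(A)(\alpha^c x)-AQ_\alpha(A)x$. A strongly continuous right linear semigroup is a map $T:[0,\infty)\to\mathcal L^r(X)$ with $T(0)=\mathrm{Id}$, $T(t+s)=T(t)T(s)$ and $t\mapsto T(t)x$ continuous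 for all $x\in X$; its generator is $Ax=\lim_{h\to0^+}(T(h)x-x)/h$, with domain the set of all $x$ for which this limit exists. Theorem. (a) Let $A:D(A)\to X$ be closed and right linear with $D(A)$ dense in $X$, and let $M\ge1$, $w\in\mathbb R$ be such that $]w,\infty[\,\subseteq\rho_s(A)$ and $\|C_\lambda(A)^n\|\le M/(\lambda-w)^n$ for all $n\in\mathbb N$ and all $\lambda>w$. Then, for every natural number $n>w$, the operator $A_n:=nA\,C_n(A)$ belongs to $\mathcal L^r(X)$; for all $t\ge0$, $x\in X$ the limit $T(t)x=\lim_{n\to\infty}e^{tA_n}x$ exists; $T$ is a strongly continuous right linear semigroup whose generator is $A$; and $\|T(t)\|\le Me^{wt}$ for all $t\ge0$. (b) Let $T:[0,\infty)\to\mathcal L^r(X)$ be a strongly continuous right linear semigroup. Then there are $M>1$ and $w\in\mathbb R$ such that $\|T(t)\|\le Me^{wt}$ for all $t\ge0$. Its generator $A$ is right linear and closed, and $D(A)$ is dense in $X$. For all $M\ge1$ and $w\in\mathbb R$ with $\|T(t)\|\le Me^{wt}$ for all $t\ge0$, one has $]w,\infty[\,\subseteq\rho_s(A)$ and $\|C_\lambda(A)^n\|\le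 M/(\lambda-w)^n$ for all $n\in\mathbb N$ and all $\lambda>w$. In both cases, $C_\lambda(A)x=\int_0^\infty e^{-t\lambda}T(t)x\,dt$ for all $\lambda>w$ and $x\in X$, the integral being absolutely convergent. -/

import Mathlib

open Filter Topology MeasureTheory
open scoped NNReal RightActions

/-! ### Real alternative *-algebras and their quadratic cone -/

/-- The quadratic cone of a real *-algebra: the real multiples of `1`, together with the elements
whose trace `a + star a` and squared norm `a * star a` are real numbers `t`, `n`
with `t ^ 2 - 4 * n < 0`. -/
def quadraticCone (𝔸 : Type*) [NonAssocRing 𝔸] [Module ℝ 𝔸] [StarRing 𝔸] : Set 𝔸 :=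
  {a | ∃ r : ℝ, a = r • (1 : 𝔸)} ∪
    {a | ∃ t n : ℝ, a + star a = t • (1 : 𝔸) ∧ a * star a = n • (1 : 𝔸) ∧ t ^ 2 - 4 * n < 0}

/-- `𝔸` is a nonzero finite dimensional real alternative *-algebra with unity, possessing a square
root of `-1` in its quadratic cone, and endowed with a norm of real vector space which is
the square root of `a * star a` on the quadratic cone. No associativity and no
submultiplicativity of the norm are required. -/
class AlternativeStarAlgebra (𝔸 : Type*) [NonAssocRing 𝔸] [Module ℝ 𝔸] [StarRing 𝔸]
    [Norm 𝔸] : Prop where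
  nontrivial : Nontrivial 𝔸
  finite_dimensional : FiniteDimensional ℝ 𝔸
  smul_mul_left : ∀ (r : ℝ) (a b : 𝔸), (r • a) * b = r • (a * b)
  mul_smul_right : ∀ (r : ℝ) (a b : 𝔸), a * (r • b) = r • (a * b)
  left_alternative : ∀ a b : 𝔸, a * (a * b) = (a * a) * b
  right_alternative : ∀ a b : 𝔸, (a * b) * b = a * (b * b)
  star_real_smul : ∀ (r : ℝ) (a : 𝔸), star (r • a) = r • star a
  norm_eq_zero : ∀ a : 𝔸, ‖a‖ = 0 ↔ a = 0
  norm_add_le : ∀ a b : 𝔸, ‖a + b‖ ≤ ‖a‖ + ‖b‖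
  norm_real_smul : ∀ (r : ℝ) (a : 𝔸), ‖r • a‖ = |r| * ‖a‖
  norm_cone : ∀ a ∈ quadraticCone 𝔸, ∀ n : ℝ, a * star a = n • (1 : 𝔸) → ‖a‖ = √n
  exists_sqrt_neg_one : ∃ j ∈ quadraticCone 𝔸, j * j = -1

/-- The real part of an element `a` of the quadratic cone: the real number
`(a + star a) / 2`. -/
noncomputable def coneRe {𝔸 : Type*} [NonAssocRing 𝔸] [Module ℝ 𝔸] [StarRing 𝔸] (a : 𝔸) : ℝ :=
  Classical.epsilon fun r : ℝ => (2⁻¹ : ℝ) • (a + star a) = r • (1 : 𝔸)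

/-! ### Banach bimodules -/

/-- `X` is a normed `𝔸`-bimodule; the left and right scalar multiplications are written `a • x` and
`x <• a`, and the real vector space structure of `X` is the one induced by `ℝ = ℝ • 1 ⊆ 𝔸`.
It is a Banach `𝔸`-bimodule if moreover `CompleteSpace X`. -/
class NormedAltBimodule (𝔸 X : Type*) [NonAssocRing 𝔸] [Module ℝ 𝔸] [StarRing 𝔸] [Norm 𝔸]
    [NormedAddCommGroup X] [NormedSpace ℝ X] [SMul 𝔸 X] [SMul 𝔸ᵐᵒᵖ X] : Prop where
  left_smul_add : ∀ (a : 𝔸) (x y : X), a • (x + y) = a • x + a • y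
  left_add_smul : ∀ (a b : 𝔸) (x : X), (a + b) • x = a • x + b • x
  left_real_smul : ∀ (r : ℝ) (x : X), (r • (1 : 𝔸)) • x = r • x
  right_smul_add : ∀ (a : 𝔸) (x y : X), (x + y) <• a = x <• a + y <• a
  right_add_smul : ∀ (a b : 𝔸) (x : X), x <• (a + b) = x <• a + x <• b
  right_real_smul : ∀ (r : ℝ) (x : X), x <• (r • (1 : 𝔸)) = r • x
  left_assoc : (∀ a b c : 𝔸, (a * b) * c = a * (b * c)) →
    ∀ (a b : 𝔸) (x : X), a • (b • x) = (a * b) • x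
  right_assoc : (∀ a b c : 𝔸, (a * b) * c = a * (b * c)) →
    ∀ (a b : 𝔸) (x : X), (x <• a) <• b = x <• (a * b)
  middle_assoc : (∀ a b c : 𝔸, (a * b) * c = a * (b * c)) →
    ∀ (a b : 𝔸) (x : X), a • (x <• b) = (a • x) <• b
  norm_left_le : ∀ (a : 𝔸) (x : X), ‖a • x‖ ≤ ‖a‖ * ‖x‖
  norm_right_le : ∀ (a : 𝔸) (x : X), ‖x <• a‖ ≤ ‖a‖ * ‖x‖
  norm_left_cone : ∀ a ∈ quadraticCone 𝔸, ∀ x : X, ‖a • x‖ = ‖a‖ * ‖x‖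
  norm_right_cone : ∀ a ∈ quadraticCone 𝔸, ∀ x : X, ‖x <• a‖ = ‖a‖ * ‖x‖

/-! ### Right linear operators -/

/-- A bounded operator on `X` (an element of `L(X)` for the real Banach space `X`) is
right linear. -/
def IsRightLinear (𝔸 : Type*) {X : Type*} [NormedAddCommGroup X] [NormedSpace ℝ X]
    [SMul 𝔸ᵐᵒᵖ X] (B : X →L[ℝ] X) : Prop :=
  ∀ (x : X) (a : 𝔸), B (x <• a) = B x <• a

/-- A partially defined operator is right linear: its domain is a right `𝔸`-submodule and
it commutes with the right scalar multiplications. -/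
def IsRightLinearPMap (𝔸 : Type*) {X : Type*} [NormedAddCommGroup X] [NormedSpace ℝ X]
    [SMul 𝔸ᵐᵒᵖ X] (A : X →ₗ.[ℝ] X) : Prop :=
  ∀ (x : A.domain) (a : 𝔸), ∃ h : (x : X) <• a ∈ A.domain, A ⟨(x : X) <• a, h⟩ = A x <• a

section Operators

variable {X : Type*} [NormedAddCommGroup X] [NormedSpace ℝ X]

/-- The domain of `A ^ 2`: all `x` in the domain of `A` with `A x` in the domain of `A`. -/
def sqDomain (A : X →ₗ.[ℝ] X) : Submodule ℝ X where
  carrier := {x | ∃ h : x ∈ A.domain, A ⟨x, h⟩ ∈ A.domain}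
  zero_mem' := ⟨A.domain.zero_mem, by
    have h : A ⟨0, A.domain.zero_mem⟩ = 0 := A.map_zero
    rw [h]; exact A.domain.zero_mem⟩
  add_mem' := by
    rintro x y ⟨hx, hAx⟩ ⟨hy, hAy⟩
    refine ⟨A.domain.add_mem hx hy, ?_⟩
    have h : A ⟨x + y, A.domain.add_mem hx hy⟩ = A ⟨x, hx⟩ + A ⟨y, hy⟩ :=
      A.map_add ⟨x, hx⟩ ⟨y, hy⟩
    rw [h]; exact A.domain.add_mem hAx hAy
  smul_mem' := by
    rintro c x ⟨hx, hAx⟩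
    refine ⟨A.domain.smul_mem c hx, ?_⟩
    have h : A ⟨c • x, A.domain.smul_mem c hx⟩ = c • A ⟨x, hx⟩ := A.map_smul c ⟨x, hx⟩
    rw [h]; exact A.domain.smul_mem c hAx

theorem sqDomain_le (A : X →ₗ.[ℝ] X) : sqDomain A ≤ A.domain := fun _ h => h.1

/-- `A`, as a linear map from the domain of `A ^ 2` to the domain of `A`. -/
def sqDomainMap (A : X →ₗ.[ℝ] X) : sqDomain A →ₗ[ℝ] A.domain :=
  (A.toFun ∘ₗ Submodule.inclusion (sqDomain_le A)).codRestrict A.domain fun x => x.2.2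

/-- The composition `A ∘ B` of a closed operator `A` with a bounded operator `B` whose range lies
in the domain of `A`; it is bounded, by the closed graph theorem. -/
noncomputable def closedComp [CompleteSpace X] (A : X →ₗ.[ℝ] X) (hA : A.IsClosed)
    (B : X →L[ℝ] X) (hB : ∀ x, B x ∈ A.domain) : X →L[ℝ] X where
  toLinearMap := A.toFun ∘ₗ (B : X →ₗ[ℝ] X).codRestrict A.domain hB
  cont := by
    apply LinearMap.continuous_of_isClosed_graph
    have h : IsClosed ((fun p : X × X => (B p.1, p.2)) ⁻¹' (A.graph : Set (X × X))) :=
      IsClosed.preimage (by fun_prop) hA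
    convert h using 1
    ext ⟨x, y⟩
    simp only [SetLike.mem_coe, LinearMap.mem_graph_iff, Set.mem_preimage,
      LinearPMap.mem_graph_iff]
    constructor
    · rintro rfl
      exact ⟨⟨B x, hB x⟩, rfl, rfl⟩
    · rintro ⟨z, hz, rfl⟩
      have hz' : z = ⟨B x, hB x⟩ := Subtype.ext hz
      subst hz'
      rfl

theorem closedComp_apply [CompleteSpace X] (A : X →ₗ.[ℝ] X) (hA : A.IsClosed)
    (B : X →L[ℝ] X) (hB : ∀ x, B x ∈ A.domain) (x : X) :
    closedComp A hA B hB x = A ⟨B x, hB x⟩ := rfl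

end Operators

/-! ### Spherical resolvent set and spherical resolvent operators -/

section Spherical

variable {𝔸 X : Type*} [NonAssocRing 𝔸] [Module ℝ 𝔸] [StarRing 𝔸] [Norm 𝔸]
  [NormedAddCommGroup X] [NormedSpace ℝ X]

/-- The operator `A ^ 2 - 2 Re(a) A + |a| ^ 2`, with domain the domain of `A ^ 2`. -/
noncomputable def sphericalDelta (A : X →ₗ.[ℝ] X) (a : 𝔸) : X →ₗ.[ℝ] X where
  domain := sqDomain A
  toFun := A.toFun ∘ₗ sqDomainMap A
    - (2 * coneRe a) • (A.toFun ∘ₗ Submodule.inclusion (sqDomain_le A))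
    + (‖a‖ ^ 2) • (sqDomain A).subtype

/-- The spherical resolvent set: all `a` in the quadratic cone such that `sphericalDelta A a` is a
bijection from the domain of `A ^ 2` onto `X` whose inverse is bounded and right linear. -/
def sphericalResolventSet (𝔸 : Type*) {X : Type*} [NonAssocRing 𝔸] [Module ℝ 𝔸] [StarRing 𝔸]
    [Norm 𝔸] [NormedAddCommGroup X] [NormedSpace ℝ X] [SMul 𝔸ᵐᵒᵖ X] (A : X →ₗ.[ℝ] X) : Set 𝔸 :=
  {a | a ∈ quadraticCone 𝔸 ∧
    Function.Bijective (fun x : (sphericalDelta A a).domain => sphericalDelta A a x) ∧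
    ∃ B : X →L[ℝ] X, IsRightLinear 𝔸 B ∧
      ∀ x : (sphericalDelta A a).domain, B (sphericalDelta A a x) = (x : X)}

variable [SMul 𝔸ᵐᵒᵖ X]

/-- The inverse of `sphericalDelta A a`, for `a` in the spherical resolvent set. -/
noncomputable def sphericalQ (A : X →ₗ.[ℝ] X) {a : 𝔸} (ha : a ∈ sphericalResolventSet 𝔸 A) :
    X →L[ℝ] X :=
  ha.2.2.choose

theorem sphericalQ_mem (A : X →ₗ.[ℝ] X) {a : 𝔸} (ha : a ∈ sphericalResolventSet 𝔸 A) (x : X) :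
    sphericalQ A ha x ∈ sqDomain A := by
  obtain ⟨y, rfl⟩ := ha.2.1.2 x
  have h : sphericalQ A ha (sphericalDelta A a y) = (y : X) := ha.2.2.choose_spec.2 y
  exact h.symm ▸ y.2

variable [SMul 𝔸 X]

/-- The left multiplication `x ↦ a • x` as a bounded real linear operator. -/
noncomputable def leftMulOp [NormedAltBimodule 𝔸 X] (a : 𝔸) : X →L[ℝ] X :=
  AddMonoidHom.toRealLinearMap
    (AddMonoidHom.mk' (fun x : X => a • x) (NormedAltBimodule.left_smul_add a))
    (AddMonoidHomClass.continuous_of_bound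
      (AddMonoidHom.mk' (fun x : X => a • x) (NormedAltBimodule.left_smul_add a)) ‖a‖
      (NormedAltBimodule.norm_left_le a))

variable [NormedAltBimodule 𝔸 X] [CompleteSpace X]

/-- The spherical resolvent operator `x ↦ Q (star a • x) - A (Q x)`, where `Q` is the inverse of
`sphericalDelta A a`. -/
noncomputable def sphericalResolvent (A : X →ₗ.[ℝ] X) (hA : A.IsClosed) {a : 𝔸}
    (ha : a ∈ sphericalResolventSet 𝔸 A) : X →L[ℝ] X :=
  sphericalQ A ha ∘L leftMulOp (star a)
    - closedComp A hA (sphericalQ A ha) (fun x => sqDomain_le A (sphericalQ_mem A ha x))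

theorem sphericalResolvent_mem (A : X →ₗ.[ℝ] X) (hA : A.IsClosed) {a : 𝔸}
    (ha : a ∈ sphericalResolventSet 𝔸 A) (x : X) :
    sphericalResolvent A hA ha x ∈ A.domain :=
  A.domain.sub_mem (sqDomain_le A (sphericalQ_mem A ha _)) (sphericalQ_mem A ha x).2

/-- The operators `n A C_n(A)`, for a real number `n` in the spherical resolvent set. -/
noncomputable def yosidaApprox (A : X →ₗ.[ℝ] X) (hA : A.IsClosed) {n : ℝ}
    (hn : n • (1 : 𝔸) ∈ sphericalResolventSet 𝔸 A) : X →L[ℝ] X :=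
  n • closedComp A hA (sphericalResolvent A hA hn) (sphericalResolvent_mem A hA hn)

end Spherical

/-! ### Semigroups and their generators -/

section Semigroups

variable {X : Type*} [NormedAddCommGroup X] [NormedSpace ℝ X]

/-- `T` is a strongly continuous semigroup of bounded right linear operators. -/
structure IsRightC0Semigroup (𝔸 : Type*) {X : Type*} [NormedAddCommGroup X] [NormedSpace ℝ X]
    [SMul 𝔸ᵐᵒᵖ X] (T : ℝ≥0 → X →L[ℝ] X) : Prop where
  right_linear : ∀ t, IsRightLinear 𝔸 (T t)
  map_add : ∀ t s, 0 < t → 0 < s → T (t + s) = T t ∘L T s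
  map_zero : T 0 = ContinuousLinearMap.id ℝ X
  strongly_continuous : ∀ x, Continuous fun t => T t x

/-- The difference quotient `(T h x - x) / h`. -/
noncomputable def diffQuot (T : ℝ≥0 → X →L[ℝ] X) (x : X) (h : ℝ≥0) : X :=
  (h : ℝ)⁻¹ • (T h x - x)

theorem diffQuot_add (T : ℝ≥0 → X →L[ℝ] X) (x y : X) :
    diffQuot T (x + y) = fun h => diffQuot T x h + diffQuot T y h := by
  funext h
  simp only [diffQuot, _root_.map_add, ← smul_add]
  congr 1
  abel

theorem diffQuot_smul (T : ℝ≥0 → X →L[ℝ] X) (c : ℝ) (x : X) :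
    diffQuot T (c • x) = fun h => c • diffQuot T x h := by
  funext h
  simp only [diffQuot, _root_.map_smul, ← smul_sub]
  rw [smul_comm]

/-- The generator of `T`: the operator `A x = lim (T h x - x) / h` as `h → 0`, `h > 0`, defined
for those `x` for which the limit exists. -/
noncomputable def semigroupGenerator (T : ℝ≥0 → X →L[ℝ] X) : X →ₗ.[ℝ] X where
  domain :=
    { carrier := {x | ∃ y, Tendsto (diffQuot T x) (𝓝[>] 0) (𝓝 y)}
      zero_mem' := ⟨0, by
        have h : diffQuot T 0 = fun _ => 0 := by funext h; simp [diffQuot]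
        rw [h]; exact tendsto_const_nhds⟩
      add_mem' := by
        rintro x y ⟨u, hu⟩ ⟨v, hv⟩
        exact ⟨u + v, by rw [diffQuot_add]; exact hu.add hv⟩
      smul_mem' := by
        rintro c x ⟨u, hu⟩
        exact ⟨c • u, by rw [diffQuot_smul]; exact hu.const_smul c⟩ }
  toFun :=
    { toFun := fun x => x.2.choose
      map_add' := fun x y => by
        refine tendsto_nhds_unique (x + y).2.choose_spec ?_
        rw [Submodule.coe_add, diffQuot_add]
        exact x.2.choose_spec.add y.2.choose_spec
      map_smul' := fun c x => by
        refine tendsto_nhds_unique (c • x).2.choose_spec ?_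
        rw [Submodule.coe_smul, diffQuot_smul]
        exact x.2.choose_spec.const_smul c }

/-- `C x = ∫₀^∞ e^{-l t} T(t) x dt` for every `x`, the integrals being absolutely convergent. -/
def IsLaplaceTransformAt (T : ℝ≥0 → X →L[ℝ] X) (l : ℝ) (C : X →L[ℝ] X) : Prop :=
  ∀ x : X, IntegrableOn (fun t : ℝ => Real.exp (-(t * l)) • T t.toNNReal x) (Set.Ioi 0) ∧
    C x = ∫ t in Set.Ioi (0 : ℝ), Real.exp (-(t * l)) • T t.toNNReal x

end Semigroups

/-!
At a real number `l` the operator `sphericalDelta A l` is `(l - A) ^ 2`. Hence `l` belongs to the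
spherical resolvent set exactly when `l - A` has a bounded right linear inverse, and the spherical
resolvent operator at `l` is this inverse (`isResolventAt_sphericalResolvent`,
`IsResolventAt.mem_sphericalResolventSet`). All hypotheses and conclusions concern real `l` only, so
the theorem is the Hille–Yosida–Phillips theorem on the real Banach space `X`, together with the
remark that every operator obtained on the way commutes with the right multiplications by elements
of the algebra.

From semigroup to generator: if `‖T t‖ ≤ M exp (w t)` and `w < l`, the Laplace transform of `T` at
`l` exists, commutes with `T`, and is the resolvent of the generator, by differentiating
`T h (R x)` at `h = 0` (`IsLaplaceTransformAt.isResolventAt`). The bounds on the powers of `R` come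
from an induction on the estimate for `T t ∘ R ^ n` (`IsLaplaceTransformAt.norm_pow_le`). The
generator is closed because it has a resolvent, and densely defined because it contains the averages
of orbits.

From generator to semigroup: the Yosida approximations `A_r = r A R_r = r (r R_r - 1)` commute,
satisfy `‖exp (t A_r)‖ ≤ M exp (r w t / (r - w))`, and converge to `A` on its domain. The estimate
`norm_exp_smul_apply_sub_le` makes `exp (t A_r) x` Cauchy on the dense domain, hence everywhere, and
the limit is a strongly continuous semigroup whose generator extends `A`
(`exists_isC0Semigroup_of_tendsto`). By the first half this generator has a resolvent at some point
where `A` has one, so the two operators coincide (`IsResolventAt.eq_of_le`). Uniqueness of the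
resolvent then yields the integral formula.
-/

/-! ### Resolvents of unbounded operators -/

section Resolvents

variable {X : Type*} [NormedAddCommGroup X] [NormedSpace ℝ X]

/-- `R` is a bounded everywhere defined two-sided inverse of `l - A`, for a real number `l`. -/
structure IsResolventAt (A : X →ₗ.[ℝ] X) (l : ℝ) (R : X →L[ℝ] X) : Prop where
  mem : ∀ x, R x ∈ A.domain
  right_inv : ∀ x, l • R x - A ⟨R x, mem x⟩ = x
  left_inv : ∀ x : A.domain, R (l • (x : X) - A x) = x

namespace IsResolventAt

variable {A B : X →ₗ.[ℝ] X} {l m : ℝ} {R S : X →L[ℝ] X}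

theorem apply_eq (h : IsResolventAt A l R) (x : X) : A ⟨R x, h.mem x⟩ = l • R x - x := by
  have := h.right_inv x
  rw [sub_eq_iff_eq_add] at this
  rw [this]; abel

theorem apply_comm (h : IsResolventAt A l R) (x : A.domain) :
    R (A x) = A ⟨R x, h.mem x⟩ := by
  rw [h.apply_eq]
  have := h.left_inv x
  rw [map_sub, map_smul] at this
  rw [eq_sub_iff_add_eq, add_comm, ← eq_sub_iff_add_eq, this]

/-- An operator with a resolvent at `l` has no proper extension with a resolvent at `l`, because
`l - A` is already onto and the extended `l - B` is injective. -/
theorem eq_of_le (hA : IsResolventAt A l R) (hB : IsResolventAt B l S) (hAB : A ≤ B) :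
    A = B := by
  refine LinearPMap.eq_of_le_of_domain_eq hAB (le_antisymm hAB.1 fun x hx => ?_)
  have h1 := hB.left_inv ⟨x, hx⟩
  set z := l • x - B ⟨x, hx⟩ with hz
  have h2 : B ⟨R z, hAB.1 (hA.mem z)⟩ = A ⟨R z, hA.mem z⟩ := (hAB.2 rfl).symm
  have h3 := hB.left_inv ⟨R z, hAB.1 (hA.mem z)⟩
  rw [h2, hA.right_inv] at h3
  have h4 : R z = x := h3.symm.trans h1
  exact h4 ▸ hA.mem z

protected theorem unique (hR : IsResolventAt A l R) (hS : IsResolventAt A l S) : R = S := by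
  ext x
  have h := hS.left_inv ⟨R x, hR.mem x⟩
  rw [hR.right_inv] at h
  exact h.symm

/-- The resolvent identity. -/
theorem sub_eq (hR : IsResolventAt A l R) (hS : IsResolventAt A m S) :
    R - S = (m - l) • (R * S) := by
  ext x
  have h := hR.left_inv ⟨S x, hS.mem x⟩
  rw [hS.apply_eq] at h
  have h' : S x = (l - m) • R (S x) + R x := by
    refine Eq.trans h.symm ?_
    simp only [map_sub, map_smul, sub_smul]
    abel
  simp only [sub_apply, smul_apply, mul_apply_eq_comp]
  nth_rewrite 1 [h']
  simp only [sub_smul]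
  abel

protected theorem commute (hR : IsResolventAt A l R) (hS : IsResolventAt A m S) :
    Commute R S := by
  rcases eq_or_ne l m with rfl | hlm
  · rw [hR.unique hS]
  have h1 := hR.sub_eq hS
  have h2 := hS.sub_eq hR
  have h3 : (m - l) • (R * S) = (m - l) • (S * R) := by
    rw [← h1, ← neg_sub S R, h2, ← neg_smul, neg_sub]
  exact smul_right_injective _ (sub_ne_zero.2 hlm.symm) h3

/-- The graph of `A` is the preimage of a closed set: it consists of the pairs `(x, y)`
with `x = R (l x - y)`. -/
theorem isClosed (h : IsResolventAt A l R) : A.IsClosed := by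
  have hc : IsClosed {p : X × X | p.1 = R (l • p.1 - p.2)} :=
    isClosed_eq continuous_fst (by fun_prop)
  have he : (A.graph : Set (X × X)) = {p : X × X | p.1 = R (l • p.1 - p.2)} := by
    ext ⟨x, y⟩
    simp only [SetLike.mem_coe, LinearPMap.mem_graph_iff, Set.mem_ofPred_eq]
    constructor
    · rintro ⟨z, rfl, rfl⟩
      exact (h.left_inv z).symm
    · intro hx
      refine ⟨⟨R (l • x - y), h.mem _⟩, hx.symm, ?_⟩
      rw [h.apply_eq, ← hx]
      abel
  rw [LinearPMap.IsClosed, he]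
  exact hc

end IsResolventAt

end Resolvents

/-! ### Real points of the spherical resolvent set -/

section RealSpherical

variable {𝔸 X : Type*} [NonAssocRing 𝔸] [Module ℝ 𝔸] [StarRing 𝔸] [Norm 𝔸]
  [AlternativeStarAlgebra 𝔸] [NormedAddCommGroup X] [NormedSpace ℝ X]

theorem star_smul_one (l : ℝ) : star (l • (1 : 𝔸)) = l • (1 : 𝔸) := by
  rw [AlternativeStarAlgebra.star_real_smul, star_one]

theorem coneRe_smul_one (l : ℝ) : coneRe (l • (1 : 𝔸)) = l := by
  have := AlternativeStarAlgebra.nontrivial (𝔸 := 𝔸)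
  have h : (2⁻¹ : ℝ) • (l • (1 : 𝔸) + star (l • (1 : 𝔸))) = l • (1 : 𝔸) := by
    rw [star_smul_one, ← two_smul ℝ, smul_smul]
    norm_num
  have h' := Classical.epsilon_spec
    (p := fun r : ℝ => (2⁻¹ : ℝ) • (l • (1 : 𝔸) + star (l • (1 : 𝔸))) = r • (1 : 𝔸)) ⟨l, h⟩
  exact (smul_left_injective ℝ (one_ne_zero (α := 𝔸)) (h.symm.trans h')).symm

theorem norm_smul_one (l : ℝ) : ‖l • (1 : 𝔸)‖ = |l| := by
  have h := AlternativeStarAlgebra.norm_cone (1 : 𝔸) (Or.inl ⟨1, (one_smul _ _).symm⟩) 1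
    (by rw [star_one, mul_one, one_smul])
  rw [AlternativeStarAlgebra.norm_real_smul, h, Real.sqrt_one, mul_one]

theorem sphericalDelta_smul_one_apply (A : X →ₗ.[ℝ] X) (l : ℝ) (x : X) (hx : x ∈ A.domain)
    (hAx : A ⟨x, hx⟩ ∈ A.domain) :
    sphericalDelta A (l • (1 : 𝔸)) ⟨x, hx, hAx⟩ =
      l • (l • x - A ⟨x, hx⟩) - (l • A ⟨x, hx⟩ - A ⟨A ⟨x, hx⟩, hAx⟩) := by
  have h : sphericalDelta A (l • (1 : 𝔸)) ⟨x, hx, hAx⟩ =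
      A ⟨A ⟨x, hx⟩, hAx⟩ - (2 * coneRe (l • (1 : 𝔸))) • A ⟨x, hx⟩
        + (‖l • (1 : 𝔸)‖ ^ 2) • x := rfl
  rw [h, coneRe_smul_one, norm_smul_one, sq_abs]
  module

variable [SMul 𝔸ᵐᵒᵖ X]

/-- For a real number `l` the operator `sphericalDelta A l` is `(l - A) ^ 2`, so that a right linear
resolvent `R` of `A` at `l` provides the right linear inverse `R ^ 2`. -/
theorem IsResolventAt.mem_sphericalResolventSet {A : X →ₗ.[ℝ] X} {l : ℝ} {R : X →L[ℝ] X}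
    (h : IsResolventAt A l R) (hR : IsRightLinear 𝔸 R) :
    l • (1 : 𝔸) ∈ sphericalResolventSet 𝔸 A := by
  have hinv : ∀ x : (sphericalDelta A (l • (1 : 𝔸))).domain,
      (R ∘L R) (sphericalDelta A (l • (1 : 𝔸)) x) = (x : X) := by
    rintro ⟨x, hx, hAx⟩
    rw [sphericalDelta_smul_one_apply _ _ _ hx hAx]
    have hm : l • x - A ⟨x, hx⟩ ∈ A.domain := A.domain.sub_mem (A.domain.smul_mem _ hx) hAx
    have e : A ⟨l • x - A ⟨x, hx⟩, hm⟩ = l • A ⟨x, hx⟩ - A ⟨A ⟨x, hx⟩, hAx⟩ := by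
      rw [← LinearPMap.map_smul, ← LinearPMap.map_sub]; rfl
    rw [← e, ContinuousLinearMap.comp_apply, h.left_inv ⟨_, hm⟩]
    exact h.left_inv ⟨x, hx⟩
  refine ⟨Or.inl ⟨l, rfl⟩, ⟨fun x y hxy => ?_, fun x => ?_⟩, R ∘L R,
    fun x a => by simp [hR x a, hR (R x) a], hinv⟩
  · apply Subtype.ext
    have hxy' : sphericalDelta A (l • (1 : 𝔸)) x = sphericalDelta A (l • (1 : 𝔸)) y := hxy
    rw [← hinv x, ← hinv y, hxy']
  · have h1 : A ⟨R (R x), h.mem _⟩ ∈ A.domain := by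
      rw [h.apply_eq]
      exact A.domain.sub_mem (A.domain.smul_mem _ (h.mem _)) (h.mem _)
    refine ⟨⟨R (R x), h.mem _, h1⟩, ?_⟩
    change sphericalDelta A (l • (1 : 𝔸)) ⟨R (R x), h.mem _, h1⟩ = x
    rw [sphericalDelta_smul_one_apply _ _ _ (h.mem _) h1, ← LinearPMap.map_smul,
      ← LinearPMap.map_sub]
    simp only [h.right_inv]
    have e : l • (⟨R (R x), h.mem _⟩ : A.domain) - ⟨A ⟨R (R x), h.mem _⟩, h1⟩ =
        ⟨R x, h.mem x⟩ := Subtype.ext (h.right_inv (R x))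
    rw [e, h.right_inv]

variable [SMul 𝔸 X] [NormedAltBimodule 𝔸 X] [CompleteSpace X]

theorem sphericalResolvent_smul_one_apply (A : X →ₗ.[ℝ] X) (hA : A.IsClosed) {l : ℝ}
    (hl : l • (1 : 𝔸) ∈ sphericalResolventSet 𝔸 A) (x : X) :
    sphericalResolvent A hA hl x = l • sphericalQ A hl x -
      A ⟨sphericalQ A hl x, sqDomain_le A (sphericalQ_mem A hl x)⟩ := by
  have h : sphericalResolvent A hA hl x = sphericalQ A hl (star (l • (1 : 𝔸)) • x) -
      A ⟨sphericalQ A hl x, sqDomain_le A (sphericalQ_mem A hl x)⟩ := rfl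
  rw [h, star_smul_one, NormedAltBimodule.left_real_smul, map_smul]

/-- At a real point `l` of the spherical resolvent set, the spherical resolvent operator is the
ordinary resolvent `(l - A)⁻¹`. -/
theorem isResolventAt_sphericalResolvent (A : X →ₗ.[ℝ] X) (hA : A.IsClosed) {l : ℝ}
    (hl : l • (1 : 𝔸) ∈ sphericalResolventSet 𝔸 A) :
    IsResolventAt A l (sphericalResolvent A hA hl) := by
  have hright : ∀ x, l • sphericalResolvent A hA hl x -
      A ⟨sphericalResolvent A hA hl x, sphericalResolvent_mem A hA hl x⟩ = x := fun x => by
    obtain ⟨hq, hAq⟩ := sphericalQ_mem A hl x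
    have h1 : sphericalDelta A (l • (1 : 𝔸)) ⟨sphericalQ A hl x, hq, hAq⟩ = x := by
      obtain ⟨y, hy⟩ := hl.2.1.2 x
      have hy' : sphericalDelta A (l • (1 : 𝔸)) y = x := hy
      have h2 : sphericalQ A hl (sphericalDelta A (l • (1 : 𝔸)) y) = (y : X) :=
        hl.2.2.choose_spec.2 y
      have h3 : (⟨sphericalQ A hl x, hq, hAq⟩ : (sphericalDelta A (l • (1 : 𝔸))).domain) = y :=
        Subtype.ext (by rw [← h2, hy'])
      rw [h3, hy']
    rw [sphericalDelta_smul_one_apply _ _ _ hq hAq, ← LinearPMap.map_smul,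
      ← LinearPMap.map_sub] at h1
    have e : l • (⟨sphericalQ A hl x, hq⟩ : A.domain) - ⟨A ⟨sphericalQ A hl x, hq⟩, hAq⟩ =
        ⟨sphericalResolvent A hA hl x, sphericalResolvent_mem A hA hl x⟩ :=
      Subtype.ext (sphericalResolvent_smul_one_apply A hA hl x).symm
    rw [e, ← sphericalResolvent_smul_one_apply A hA hl x] at h1
    exact h1
  have hinj : ∀ z : A.domain, l • (z : X) - A z = 0 → (z : X) = 0 := by
    rintro ⟨z, hz⟩ h
    have hAz : A ⟨z, hz⟩ = l • z := (sub_eq_zero.1 h).symm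
    have hAz' : A ⟨z, hz⟩ ∈ A.domain := hAz ▸ A.domain.smul_mem l hz
    have h0 : sphericalDelta A (l • (1 : 𝔸)) ⟨z, hz, hAz'⟩ = 0 := by
      rw [sphericalDelta_smul_one_apply _ _ _ hz hAz', ← LinearPMap.map_smul,
        ← LinearPMap.map_sub]
      have e : l • (⟨z, hz⟩ : A.domain) - ⟨A ⟨z, hz⟩, hAz'⟩ = 0 := Subtype.ext h
      rw [e, LinearPMap.map_zero]
      simp only at h
      rw [h, smul_zero, sub_zero]
    have := hl.2.2.choose_spec.2 ⟨z, hz, hAz'⟩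
    rw [h0, map_zero] at this
    exact this.symm
  refine ⟨sphericalResolvent_mem A hA hl, hright, fun x => ?_⟩
  have hz := hinj (⟨_, sphericalResolvent_mem A hA hl (l • (x : X) - A x)⟩ - x) (by
    rw [LinearPMap.map_sub, Submodule.coe_sub, smul_sub, sub_sub_sub_comm, hright, sub_self])
  exact sub_eq_zero.1 hz

end RealSpherical

/-! ### Right linear operators -/

section RightLinear

variable {𝔸 X : Type*} [NonAssocRing 𝔸] [Module ℝ 𝔸] [StarRing 𝔸] [Norm 𝔸]
  [NormedAddCommGroup X] [NormedSpace ℝ X] [SMul 𝔸ᵐᵒᵖ X] [SMul 𝔸 X] [NormedAltBimodule 𝔸 X]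

variable (X) in
/-- The right multiplication `x ↦ x <• a` as a bounded real linear operator. -/
noncomputable def rightMulOp (a : 𝔸) : X →L[ℝ] X :=
  AddMonoidHom.toRealLinearMap
    (AddMonoidHom.mk' (fun x : X => x <• a) (NormedAltBimodule.right_smul_add a))
    (AddMonoidHomClass.continuous_of_bound
      (AddMonoidHom.mk' (fun x : X => x <• a) (NormedAltBimodule.right_smul_add a)) ‖a‖
      (NormedAltBimodule.norm_right_le a))

theorem rightMulOp_apply (a : 𝔸) (x : X) : rightMulOp X a x = x <• a := rfl

theorem isRightLinear_iff_commute {B : X →L[ℝ] X} :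
    IsRightLinear 𝔸 B ↔ ∀ a : 𝔸, Commute B (rightMulOp X a) :=
  ⟨fun h a => ContinuousLinearMap.ext fun x => h x a,
    fun h x a => congrArg (fun C : X →L[ℝ] X => C x) (h a)⟩

theorem IsResolventAt.isRightLinear {A : X →ₗ.[ℝ] X} {l : ℝ} {R : X →L[ℝ] X}
    (hR : IsResolventAt A l R) (hA : IsRightLinearPMap 𝔸 A) : IsRightLinear 𝔸 R := by
  intro x a
  obtain ⟨h, h'⟩ := hA ⟨_, hR.mem x⟩ a
  have h1 := hR.left_inv ⟨_, h⟩
  rw [h', hR.apply_eq] at h1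
  simp only [← rightMulOp_apply, map_sub, map_smul] at h1 ⊢
  rw [← h1, ← map_smul, ← map_sub, ← map_sub, sub_sub_cancel]

end RightLinear

/-! ### Strongly continuous semigroups -/

section C0Semigroups

variable {X : Type*} [NormedAddCommGroup X] [NormedSpace ℝ X]

/-- `T` is a strongly continuous semigroup of bounded operators on the real space `X`; the scalar
action of the algebra plays no role. -/
structure IsC0Semigroup (T : ℝ≥0 → X →L[ℝ] X) : Prop where
  map_zero : T 0 = 1
  map_add : ∀ t s, T (t + s) = T t * T s
  strongly_continuous : ∀ x, Continuous fun t => T t x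

theorem IsRightC0Semigroup.isC0Semigroup {𝔸 : Type*} [SMul 𝔸ᵐᵒᵖ X] {T : ℝ≥0 → X →L[ℝ] X}
    (hT : IsRightC0Semigroup 𝔸 T) : IsC0Semigroup T where
  map_zero := hT.map_zero
  map_add t s := by
    have h0 : T 0 = 1 := hT.map_zero
    rcases eq_zero_or_pos t with rfl | ht
    · rw [zero_add, h0, one_mul]
    rcases eq_zero_or_pos s with rfl | hs
    · rw [add_zero, h0, mul_one]
    exact hT.map_add t s ht hs
  strongly_continuous := hT.strongly_continuous

theorem mem_semigroupGenerator_of_tendsto {T : ℝ≥0 → X →L[ℝ] X} {x y : X}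
    (h : Tendsto (diffQuot T x) (𝓝[>] 0) (𝓝 y)) :
    ∃ hx : x ∈ (semigroupGenerator T).domain, semigroupGenerator T ⟨x, hx⟩ = y :=
  ⟨⟨y, h⟩, tendsto_nhds_unique
    (Exists.choose_spec (⟨y, h⟩ : ∃ y, Tendsto (diffQuot T x) (𝓝[>] 0) (𝓝 y))) h⟩

theorem tendsto_diffQuot (T : ℝ≥0 → X →L[ℝ] X) (x : (semigroupGenerator T).domain) :
    Tendsto (diffQuot T x) (𝓝[>] 0) (𝓝 (semigroupGenerator T x)) :=
  Exists.choose_spec x.2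

theorem tendsto_diffQuot_of_hasDerivAt {T : ℝ≥0 → X →L[ℝ] X} {x y : X} {f : ℝ → X}
    (hf : HasDerivAt f y 0) (h0 : f 0 = x) (hT : ∀ h : ℝ≥0, T h x = f h) :
    Tendsto (diffQuot T x) (𝓝[>] 0) (𝓝 y) := by
  have h1 := hf.tendsto_slope_zero_right
  have h2 : Tendsto ((↑) : ℝ≥0 → ℝ) (𝓝[>] 0) (𝓝[>] 0) := by
    refine tendsto_nhdsWithin_iff.2 ⟨?_, ?_⟩
    · exact (NNReal.continuous_coe.tendsto' 0 0 rfl).mono_left nhdsWithin_le_nhds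
    · exact eventually_nhdsWithin_of_forall fun t ht => NNReal.coe_pos.2 ht
  refine (h1.comp h2).congr fun h => ?_
  simp [diffQuot, hT, h0]

theorem map_mem_semigroupGenerator {T : ℝ≥0 → X →L[ℝ] X} {C : X →L[ℝ] X}
    (hC : ∀ t, Commute C (T t)) (x : (semigroupGenerator T).domain) :
    ∃ h : C x ∈ (semigroupGenerator T).domain,
      semigroupGenerator T ⟨C x, h⟩ = C (semigroupGenerator T x) := by
  refine mem_semigroupGenerator_of_tendsto
    (((C.continuous.tendsto _).comp (tendsto_diffQuot T x)).congr fun h => ?_)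
  have h1 : C (T h x) = T h (C x) := congrArg (fun B : X →L[ℝ] X => B x) (hC h)
  simp [diffQuot, h1]

namespace IsC0Semigroup

variable {T : ℝ≥0 → X →L[ℝ] X}

theorem apply_add (hT : IsC0Semigroup T) (t s : ℝ≥0) (x : X) : T (t + s) x = T t (T s x) := by
  rw [hT.map_add, mul_apply_eq_comp]

theorem commute (hT : IsC0Semigroup T) (t s : ℝ≥0) : Commute (T t) (T s) := by
  rw [commute_iff_eq, ← hT.map_add, add_comm, hT.map_add]

theorem continuous_toNNReal (hT : IsC0Semigroup T) (x : X) :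
    Continuous fun t : ℝ => T t.toNNReal x :=
  (hT.strongly_continuous x).comp continuous_real_toNNReal

/-- By the uniform boundedness principle `T` is bounded on `[0, 1]`, hence of exponential growth. -/
theorem exists_norm_le [CompleteSpace X] (hT : IsC0Semigroup T) :
    ∃ M w : ℝ, 1 < M ∧ ∀ t : ℝ≥0, ‖T t‖ ≤ M * Real.exp (w * t) := by
  obtain ⟨C, hC⟩ := banach_steinhaus (g := fun t : Set.Icc (0 : ℝ≥0) 1 => T t) fun x => by
    obtain ⟨C, hC⟩ := isCompact_Icc.exists_bound_of_continuousOn (s := Set.Icc (0 : ℝ≥0) 1)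
      (hT.strongly_continuous x).continuousOn
    exact ⟨C, fun t => hC t t.2⟩
  set K := max C 2 with hK
  have hK2 : 2 ≤ K := le_max_right _ _
  have hK0 : 0 < K := by linarith
  have hsmall : ∀ t : ℝ≥0, t ≤ 1 → ‖T t‖ ≤ K := fun t ht =>
    (hC ⟨t, zero_le, ht⟩).trans (le_max_left _ _)
  have hind : ∀ (n : ℕ) (t : ℝ≥0), t ≤ 1 → ‖T (n + t)‖ ≤ K ^ n * K := by
    intro n
    induction n with
    | zero => intro t ht; simpa using hsmall t ht
    | succ n ih =>
      intro t ht
      have e : ((n + 1 : ℕ) : ℝ≥0) + t = 1 + (n + t) := by push_cast; ring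
      rw [e, hT.map_add, pow_succ', mul_assoc]
      exact (norm_mul_le _ _).trans (mul_le_mul (hsmall 1 le_rfl) (ih t ht) (norm_nonneg _) hK0.le)
  refine ⟨K, Real.log K, by linarith, fun t => ?_⟩
  have hfl : (⌊t⌋₊ : ℝ≥0) ≤ t := Nat.floor_le zero_le
  have h1 := hind ⌊t⌋₊ (t - ⌊t⌋₊) (tsub_le_iff_left.2 (Nat.lt_floor_add_one t).le)
  rw [add_tsub_cancel_of_le hfl] at h1
  refine h1.trans ?_
  rw [mul_comm]
  gcongr
  rw [← Real.rpow_natCast, Real.rpow_def_of_pos hK0]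
  gcongr
  · exact Real.log_nonneg (by linarith)
  · exact_mod_cast hfl

/-- The averages `h⁻¹ • ∫ t in 0..h, T t x` belong to the domain of the generator and converge
to `x`. -/
theorem dense_domain [CompleteSpace X] (hT : IsC0Semigroup T) :
    Dense ((semigroupGenerator T).domain : Set X) := by
  intro x
  set u : ℝ → X := fun t => T t.toNNReal x with hu
  have huc : Continuous u := hT.continuous_toNNReal x
  set U : ℝ → X := fun h => ∫ t in (0 : ℝ)..h, u t with hU
  have hUd : ∀ h, HasDerivAt U (u h) h := fun h => huc.integral_hasStrictDerivAt 0 h |>.hasDerivAt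
  have hu0 : u 0 = x := by simp [hu, hT.map_zero]
  have hmem : ∀ h : ℝ, 0 ≤ h → U h ∈ (semigroupGenerator T).domain := by
    intro h hh
    have hder : HasDerivAt (fun k => U (h + k) - U k) (u h - u 0) 0 := by
      refine HasDerivAt.sub ?_ (hUd 0)
      refine HasDerivAt.comp_const_add h 0 ?_
      simpa using hUd h
    refine (mem_semigroupGenerator_of_tendsto
      (tendsto_diffQuot_of_hasDerivAt hder (by simp [hU]) fun k => ?_)).1
    rw [hU]
    simp only
    rw [← ContinuousLinearMap.intervalIntegral_comp_comm _ (huc.intervalIntegrable _ _),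
      intervalIntegral.integral_interval_sub_left (huc.intervalIntegrable _ _)
        (huc.intervalIntegrable _ _)]
    have e : (∫ t in (k : ℝ)..h + k, u t) = ∫ t in (0 : ℝ)..h, u (t + k) := by
      rw [intervalIntegral.integral_comp_add_right, zero_add]
    rw [e]
    refine intervalIntegral.integral_congr fun t ht => ?_
    rw [Set.uIcc_of_le hh] at ht
    simp only [hu]
    rw [Real.toNNReal_add ht.1 k.coe_nonneg, Real.toNNReal_coe, add_comm, hT.apply_add]
  have hlim := (hUd 0).tendsto_slope_zero_right
  rw [hu0] at hlim
  refine mem_closure_of_tendsto hlim ?_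
  refine eventually_nhdsWithin_of_forall fun h hh => ?_
  have hU0 : U 0 = 0 := by simp [hU]
  rw [zero_add, hU0, sub_zero]
  exact (semigroupGenerator T).domain.smul_mem _ (hmem h (le_of_lt hh))

end IsC0Semigroup

/-! ### Laplace transforms of semigroups -/

theorem integrableOn_exp_smul_of_norm_le {f : ℝ → X} {K w l : ℝ} (hl : w < l)
    (hfc : Continuous f) (hf : ∀ t, 0 < t → ‖f t‖ ≤ K * Real.exp (w * t)) :
    IntegrableOn (fun t => Real.exp (-(t * l)) • f t) (Set.Ioi 0) := by
  refine Integrable.mono' ((integrableOn_exp_mul_Ioi (sub_neg.2 hl) 0).const_mul K)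
    (Continuous.aestronglyMeasurable (by fun_prop)) ?_
  refine (ae_restrict_iff' measurableSet_Ioi).2 (ae_of_all _ fun t ht => ?_)
  rw [norm_smul, Real.norm_of_nonneg (Real.exp_pos _).le]
  refine (mul_le_mul_of_nonneg_left (hf t ht) (Real.exp_pos _).le).trans_eq ?_
  rw [mul_left_comm, ← Real.exp_add]
  ring_nf

theorem norm_integral_exp_smul_le {f : ℝ → X} {K w l : ℝ} (hl : w < l)
    (hf : ∀ t, 0 < t → ‖f t‖ ≤ K * Real.exp (w * t)) :
    ‖∫ t in Set.Ioi (0 : ℝ), Real.exp (-(t * l)) • f t‖ ≤ K / (l - w) := by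
  have hint := (integrableOn_exp_mul_Ioi (sub_neg.2 hl) 0).const_mul K
  have h := norm_integral_le_of_norm_le (μ := volume.restrict (Set.Ioi (0 : ℝ)))
    (f := fun t => Real.exp (-(t * l)) • f t) hint
    ((ae_restrict_iff' measurableSet_Ioi).2 (ae_of_all _ fun t ht => ?_))
  · refine h.trans_eq ?_
    rw [integral_const_mul, integral_exp_mul_Ioi (sub_neg.2 hl), mul_zero, Real.exp_zero,
      ← neg_sub l w, neg_div_neg_eq, mul_one_div]
  · rw [norm_smul, Real.norm_of_nonneg (Real.exp_pos _).le]
    refine (mul_le_mul_of_nonneg_left (hf t ht) (Real.exp_pos _).le).trans_eq ?_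
    rw [mul_left_comm, ← Real.exp_add]
    ring_nf

variable {T : ℝ≥0 → X →L[ℝ] X} {M w l : ℝ} {R : X →L[ℝ] X}

theorem norm_toNNReal_apply_le (hb : ∀ t : ℝ≥0, ‖T t‖ ≤ M * Real.exp (w * t)) (x : X) (t : ℝ)
    (ht : 0 < t) : ‖T t.toNNReal x‖ ≤ M * ‖x‖ * Real.exp (w * t) := by
  refine ((T t.toNNReal).le_of_opNorm_le (hb _) x).trans_eq ?_
  rw [Real.coe_toNNReal _ ht.le]
  ring

theorem IsC0Semigroup.exists_isLaplaceTransformAt (hT : IsC0Semigroup T)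
    (hb : ∀ t : ℝ≥0, ‖T t‖ ≤ M * Real.exp (w * t)) (hl : w < l) :
    ∃ R : X →L[ℝ] X, IsLaplaceTransformAt T l R := by
  have hint := fun x => integrableOn_exp_smul_of_norm_le hl (hT.continuous_toNNReal x)
    (norm_toNNReal_apply_le hb x)
  refine ⟨LinearMap.mkContinuous
    { toFun := fun x => ∫ t in Set.Ioi (0 : ℝ), Real.exp (-(t * l)) • T t.toNNReal x
      map_add' := fun x y => ?_
      map_smul' := fun c x => ?_ } (M / (l - w)) fun x => ?_, fun x => ⟨hint x, rfl⟩⟩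
  · rw [← integral_add (hint x) (hint y)]
    exact integral_congr_ae (ae_of_all _ fun t => by simp only [_root_.map_add, smul_add])
  · rw [← integral_smul]
    exact integral_congr_ae (ae_of_all _ fun t => by
      simp only [_root_.map_smul, RingHom.id_apply, smul_comm c])
  · refine (norm_integral_exp_smul_le hl (norm_toNNReal_apply_le hb x)).trans_eq ?_
    ring

namespace IsLaplaceTransformAt

theorem commute [CompleteSpace X] (hR : IsLaplaceTransformAt T l R) {C : X →L[ℝ] X}
    (hC : ∀ t, Commute C (T t)) : Commute C R := by
  ext x
  simp only [mul_apply_eq_comp]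
  rw [(hR x).2, (hR (C x)).2, ← ContinuousLinearMap.integral_comp_comm _ (hR x).1]
  congr 1
  ext t
  have h1 : C (T t.toNNReal x) = T t.toNNReal (C x) :=
    congrArg (fun B : X →L[ℝ] X => B x) (hC _)
  rw [map_smul, h1]

/-- `T h (R x) = exp (l h) (R x - ∫ s in 0..h, exp (-s l) T s x)` has derivative `l (R x) - x`
at `h = 0`. -/
theorem isResolventAt [CompleteSpace X] (hT : IsC0Semigroup T) (hR : IsLaplaceTransformAt T l R) :
    IsResolventAt (semigroupGenerator T) l R := by
  have key : ∀ x, ∃ hx : R x ∈ (semigroupGenerator T).domain,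
      semigroupGenerator T ⟨R x, hx⟩ = l • R x - x := by
    intro x
    set v : ℝ → X := fun t => Real.exp (-(t * l)) • T t.toNNReal x with hv
    have hvc : Continuous v :=
      Continuous.smul (by fun_prop) (hT.continuous_toNNReal x)
    set V : ℝ → X := fun h => ∫ t in (0 : ℝ)..h, v t with hV
    have hVd : HasDerivAt V (v 0) 0 := (hvc.integral_hasStrictDerivAt 0 0).hasDerivAt
    have hv0 : v 0 = x := by simp [hv, hT.map_zero]
    have hed : HasDerivAt (fun h : ℝ => Real.exp (h * l)) l 0 := by
      simpa using ((hasDerivAt_id (0 : ℝ)).mul_const l).exp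
    have hder : HasDerivAt (fun h : ℝ => Real.exp (h * l) • (R x - V h)) (l • R x - x) 0 := by
      have := hed.fun_smul (hVd.const_sub (R x))
      simp only [zero_mul, Real.exp_zero, one_smul, hv0] at this
      have hV0 : V 0 = 0 := by simp [hV]
      rw [hV0, sub_zero] at this
      rwa [neg_add_eq_sub] at this
    refine mem_semigroupGenerator_of_tendsto
      (tendsto_diffQuot_of_hasDerivAt hder (by simp [hV]) fun h => ?_)
    have hI : R x - V h = ∫ t in Set.Ioi (h : ℝ), v t := by
      have h1 : V h = _ := (intervalIntegral.integral_Ioi_sub_Ioi (hR x).1 h.coe_nonneg).symm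
      rw [h1, (hR x).2, sub_sub_cancel]
    have hshift : ∫ t in Set.Ioi (h : ℝ), v t = ∫ t in Set.Ioi (0 : ℝ), v (t + h) := by
      rw [← (measurePreserving_add_right volume (h : ℝ)).setIntegral_preimage_emb
        (measurableEmbedding_addRight _)]
      simp
    rw [hI, hshift, (hR x).2, ← ContinuousLinearMap.integral_comp_comm _ (hR x).1,
      ← integral_smul]
    refine setIntegral_congr_fun measurableSet_Ioi fun t ht => ?_
    simp only [hv]
    rw [Real.toNNReal_add (le_of_lt ht) h.coe_nonneg, Real.toNNReal_coe, add_comm t.toNNReal,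
      hT.apply_add, map_smul, smul_smul, ← Real.exp_add]
    ring_nf
  refine ⟨fun x => (key x).1, fun x => ?_, fun x => ?_⟩
  · rw [(key x).2, sub_sub_cancel]
  · obtain ⟨h, h'⟩ := map_mem_semigroupGenerator
      (fun t => (hR.commute fun s => hT.commute t s).symm) x
    rw [map_sub, map_smul, ← h', (key x).2, sub_sub_cancel]

/-- The bound for `T t ∘ R ^ n` is preserved by the induction on `n`; at `t = 0` it is the
estimate for the powers of the resolvent. -/
theorem norm_pow_le [CompleteSpace X] (hT : IsC0Semigroup T) (hR : IsLaplaceTransformAt T l R)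
    (hM : 0 ≤ M) (hb : ∀ t : ℝ≥0, ‖T t‖ ≤ M * Real.exp (w * t)) (hl : w < l) (n : ℕ) :
    ‖R ^ n‖ ≤ M / (l - w) ^ n := by
  have hlw : 0 < l - w := sub_pos.2 hl
  have key : ∀ (x : X) (n : ℕ) (t : ℝ≥0),
      ‖T t ((R ^ n) x)‖ ≤ M * ‖x‖ / (l - w) ^ n * Real.exp (w * t) := by
    intro x n
    induction n with
    | zero =>
      intro t
      refine ((T t).le_of_opNorm_le (hb t) _).trans_eq ?_
      simp
      ring
    | succ n ih =>
      intro t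
      have hcomm : T t (R ((R ^ n) x)) = R (T t ((R ^ n) x)) :=
        congrArg (fun B : X →L[ℝ] X => B ((R ^ n) x)) (hR.commute fun s => hT.commute t s)
      rw [pow_succ', mul_apply_eq_comp, hcomm, (hR _).2]
      refine (norm_integral_exp_smul_le (K := M * ‖x‖ / (l - w) ^ n * Real.exp (w * t)) hl
        fun s hs => ?_).trans_eq (by field_simp; ring)
      rw [← hT.apply_add]
      refine (ih _).trans_eq ?_
      rw [mul_assoc, ← Real.exp_add, NNReal.coe_add, Real.coe_toNNReal _ hs.le]
      ring_nf
  refine ContinuousLinearMap.opNorm_le_bound _ (by positivity) fun x => ?_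
  have := key x n 0
  rw [hT.map_zero] at this
  simp only [NNReal.coe_zero, mul_zero, Real.exp_zero, mul_one] at this
  exact this.trans_eq (by ring)

end IsLaplaceTransformAt

end C0Semigroups

/-! ### Limits of bounded families of operators -/

section StrongLimits

variable {X ι : Type*} [NormedAddCommGroup X] [NormedSpace ℝ X] {F : Filter ι}

theorem tendsto_apply_zero_of_dense {E : ι → X →L[ℝ] X} {K : ℝ} (hK : ∀ᶠ i in F, ‖E i‖ ≤ K)
    {D : Set X} (hD : Dense D) (h : ∀ x ∈ D, Tendsto (fun i => E i x) F (𝓝 0)) (x : X) :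
    Tendsto (fun i => E i x) F (𝓝 0) := by
  rw [Metric.tendsto_nhds]
  intro ε hε
  have hK' : 0 < |K| + 1 := by positivity
  obtain ⟨y, hy, hxy⟩ := hD.exists_dist_lt x (ε := ε / 2 / (|K| + 1)) (by positivity)
  filter_upwards [hK, Metric.tendsto_nhds.1 (h y hy) (ε / 2) (by positivity)] with i hi hi'
  rw [dist_zero_right] at hi' ⊢
  have h1 : ‖E i (x - y)‖ ≤ (|K| + 1) * ‖x - y‖ :=
    (E i).le_of_opNorm_le (hi.trans ((le_abs_self K).trans (by linarith))) _
  rw [dist_eq_norm, lt_div_iff₀ hK'] at hxy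
  have h2 : E i x = E i (x - y) + E i y := by rw [map_sub, sub_add_cancel]
  rw [h2]
  refine (norm_add_le _ _).trans_lt ?_
  linarith

theorem cauchy_map_apply_of_dense [F.NeBot] {E : ι → X →L[ℝ] X} {K : ℝ}
    (hK : ∀ᶠ i in F, ‖E i‖ ≤ K) {D : Set X} (hD : Dense D)
    (h : ∀ x ∈ D, Tendsto (fun p : ι × ι => E p.1 x - E p.2 x) (F ×ˢ F) (𝓝 0)) (x : X) :
    Cauchy (map (fun i => E i x) F) := by
  have h1 : Tendsto (fun p : ι × ι => (E p.1 - E p.2) x) (F ×ˢ F) (𝓝 0) := by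
    refine tendsto_apply_zero_of_dense (K := K + K) ?_ hD h x
    filter_upwards [hK.prod_mk hK] with p hp
    exact (norm_sub_le _ _).trans (add_le_add hp.1 hp.2)
  refine cauchy_map_iff.2 ⟨inferInstance, ?_⟩
  rw [Metric.uniformity_basis_dist.tendsto_right_iff]
  intro ε hε
  filter_upwards [Metric.tendsto_nhds.1 h1 ε hε] with p hp
  rw [dist_zero_right] at hp
  rw [dist_eq_norm]
  exact hp

theorem tendsto_apply_of_tendsto {E : ι → X →L[ℝ] X} {K : ℝ} (hK : ∀ᶠ i in F, ‖E i‖ ≤ K)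
    {y : ι → X} {u v : X} (hy : Tendsto y F (𝓝 u)) (hE : Tendsto (fun i => E i u) F (𝓝 v)) :
    Tendsto (fun i => E i (y i)) F (𝓝 v) := by
  have h0 : Tendsto (fun i => K * ‖y i - u‖) F (𝓝 0) := by
    have := ((tendsto_iff_norm_sub_tendsto_zero.1 hy).const_mul K)
    rwa [mul_zero] at this
  have h1 : Tendsto (fun i => E i (y i - u)) F (𝓝 0) := by
    refine squeeze_zero_norm' ?_ h0
    filter_upwards [hK] with i hi
    exact (E i).le_of_opNorm_le hi _
  have h2 := h1.add hE
  rw [zero_add] at h2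
  refine h2.congr fun i => ?_
  rw [map_sub, sub_add_cancel]

end StrongLimits

/-! ### Exponentials of bounded operators -/

section Exponentials

variable {X : Type*} [NormedAddCommGroup X] [NormedSpace ℝ X] [CompleteSpace X]

theorem hasDerivAt_exp_smul_apply (B : X →L[ℝ] X) (x : X) (t : ℝ) :
    HasDerivAt (fun s : ℝ => NormedSpace.exp (s • B) x) (NormedSpace.exp (t • B) (B x)) t := by
  have h := (hasDerivAt_exp_smul_const B t).clm_apply (hasDerivAt_const t x)
  simpa using h

theorem exp_add_smul (B : X →L[ℝ] X) (t s : ℝ) :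
    NormedSpace.exp ((t + s) • B) = NormedSpace.exp (t • B) * NormedSpace.exp (s • B) := by
  -- The addition formula for `exp` in Mathlib asks for a normed `ℚ`-algebra.
  let _ : NormedAlgebra ℚ (X →L[ℝ] X) := NormedAlgebra.restrictScalars ℚ ℝ _
  rw [add_smul, NormedSpace.exp_add_of_commute]
  exact ((Commute.refl B).smul_left t).smul_right s

/-- The derivative of `s ↦ exp (s B) (exp ((t - s) C) x)` is
`exp (s B) (exp ((t - s) C) (B x - C x))`. -/
theorem norm_exp_smul_apply_sub_le {B C : X →L[ℝ] X} (h : Commute B C) {K t : ℝ} (ht : 0 ≤ t)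
    (hB : ∀ s ∈ Set.Icc 0 t, ‖NormedSpace.exp (s • B)‖ ≤ K)
    (hC : ∀ s ∈ Set.Icc 0 t, ‖NormedSpace.exp (s • C)‖ ≤ K) (x : X) :
    ‖NormedSpace.exp (t • B) x - NormedSpace.exp (t • C) x‖ ≤ K * K * ‖B x - C x‖ * t := by
  let _ : NormedAlgebra ℚ (X →L[ℝ] X) := NormedAlgebra.restrictScalars ℚ ℝ _
  have hBC : Commute (B - C) C := h.sub_left (Commute.refl C)
  have hprod : ∀ s : ℝ, NormedSpace.exp (s • (B - C)) * NormedSpace.exp (t • C) =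
      NormedSpace.exp (s • B) * NormedSpace.exp ((t - s) • C) := by
    intro s
    rw [← NormedSpace.exp_add_of_commute ((hBC.smul_left s).smul_right t),
      ← NormedSpace.exp_add_of_commute ((h.smul_left s).smul_right (t - s))]
    congr 1
    module
  have hder : ∀ s ∈ Set.Icc 0 t, HasDerivWithinAt
      (fun s : ℝ => NormedSpace.exp (s • (B - C)) (NormedSpace.exp (t • C) x))
      (NormedSpace.exp (s • B) (NormedSpace.exp ((t - s) • C) (B x - C x))) (Set.Icc 0 t) s := by
    intro s _
    have h1 := hasDerivAt_exp_smul_apply (B - C) (NormedSpace.exp (t • C) x) s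
    have h2 : NormedSpace.exp (s • (B - C)) ((B - C) (NormedSpace.exp (t • C) x)) =
        NormedSpace.exp (s • B) (NormedSpace.exp ((t - s) • C) (B x - C x)) := by
      have e1 : (B - C) (NormedSpace.exp (t • C) x) = NormedSpace.exp (t • C) ((B - C) x) :=
        congrArg (fun D : X →L[ℝ] X => D x) ((hBC.smul_right t).exp_right)
      rw [e1]
      exact congrArg (fun D : X →L[ℝ] X => D ((B - C) x)) (hprod s)
    rw [h2] at h1
    exact h1.hasDerivWithinAt
  have hK : 0 ≤ K := (norm_nonneg _).trans (hB 0 ⟨le_rfl, ht⟩)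
  have := norm_image_sub_le_of_norm_deriv_le_segment' (C := K * K * ‖B x - C x‖) hder
    (fun s hs => ?_) t ⟨ht, le_rfl⟩
  · have e0 : NormedSpace.exp (t • (B - C)) (NormedSpace.exp (t • C) x) =
        NormedSpace.exp (t • B) x := by
      have := congrArg (fun D : X →L[ℝ] X => D x) (hprod t)
      simpa using this
    rw [e0] at this
    simpa using this
  · rw [mul_assoc]
    refine (ContinuousLinearMap.le_of_opNorm_le _ (hB s ⟨hs.1, hs.2.le⟩) _).trans ?_
    refine mul_le_mul_of_nonneg_left ?_ hK
    exact ContinuousLinearMap.le_of_opNorm_le _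
      (hC (t - s) ⟨by linarith [hs.2], by linarith [hs.1]⟩) _

/-- The exponential series is estimated termwise, so that the constant `M` appears only once; the
submultiplicative bound `exp ‖a R‖` would lose the rate `a / d`. -/
theorem norm_exp_smul_le_of_norm_pow_le {R : X →L[ℝ] X} {M d a : ℝ} (ha : 0 ≤ a)
    (hR : ∀ k : ℕ, ‖R ^ k‖ ≤ M / d ^ k) : ‖NormedSpace.exp (a • R)‖ ≤ M * Real.exp (a / d) := by
  have h1 := NormedSpace.exp_series_hasSum_exp' (𝕂 := ℝ) (a • R)
  have h2 := (NormedSpace.exp_series_hasSum_exp' (𝕂 := ℝ) (a / d)).mul_left M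
  rw [← Real.exp_eq_exp_ℝ] at h2
  refine h1.norm_le_of_bounded h2 fun k => ?_
  rw [smul_pow, norm_smul, norm_smul, Real.norm_of_nonneg (by positivity),
    Real.norm_of_nonneg (by positivity), smul_eq_mul, div_pow]
  calc ((k.factorial : ℝ)⁻¹) * (a ^ k * ‖R ^ k‖)
      ≤ ((k.factorial : ℝ)⁻¹) * (a ^ k * (M / d ^ k)) := by gcongr; exact hR k
    _ = _ := by ring

theorem exp_smul_smul_smul_sub_one (R : X →L[ℝ] X) (t r : ℝ) :
    NormedSpace.exp (t • (r • (r • R - 1))) =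
      Real.exp (-(t * r)) • NormedSpace.exp ((t * r ^ 2) • R) := by
  let _ : NormedAlgebra ℚ (X →L[ℝ] X) := NormedAlgebra.restrictScalars ℚ ℝ _
  have e : t • (r • (r • R - 1)) =
      (t * r ^ 2) • R + algebraMap ℝ (X →L[ℝ] X) (-(t * r)) := by
    rw [Algebra.algebraMap_eq_smul_one]
    module
  rw [e, NormedSpace.exp_add_of_commute (Algebra.commutes _ _).symm,
    ← NormedSpace.algebraMap_exp_comm, ← Real.exp_eq_exp_ℝ, Algebra.algebraMap_eq_smul_one,
    mul_smul_comm, mul_one]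

end Exponentials

/-! ### Convergence of approximating semigroups -/

section Approximation

variable {X ι : Type*} [NormedAddCommGroup X] [NormedSpace ℝ X]
  {F : Filter ι} {B : ι → X →L[ℝ] X} {c : ι → ℝ} {M w : ℝ} {A : X →ₗ.[ℝ] X}

theorem eventually_norm_exp_smul_le (hM : 0 ≤ M)
    (hb : ∀ i, ∀ t : ℝ, 0 ≤ t → ‖NormedSpace.exp (t • B i)‖ ≤ M * Real.exp (c i * t))
    (hc : Tendsto c F (𝓝 w)) (a : ℝ) :
    ∀ᶠ i in F, ∀ t ∈ Set.Icc 0 a, ‖NormedSpace.exp (t • B i)‖ ≤ M * Real.exp ((|w| + 1) * a) := by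
  have h1 : w < |w| + 1 := (le_abs_self w).trans_lt (by linarith)
  filter_upwards [hc.eventually_le_const h1] with i hi t ht
  refine (hb i t ht.1).trans ?_
  gcongr
  · exact ht.1
  · exact ht.2

/-- If commuting bounded operators `B i` generate uniformly exponentially bounded groups and
converge on a dense domain to `A`, then `exp (t B i)` converges strongly to a strongly continuous
semigroup whose generator extends `A`. -/
theorem exists_isC0Semigroup_of_tendsto [CompleteSpace X] [F.NeBot] [F.IsCountablyGenerated]
    (hM : 0 ≤ M) (hcomm : ∀ i j, Commute (B i) (B j))
    (hb : ∀ i, ∀ t : ℝ, 0 ≤ t → ‖NormedSpace.exp (t • B i)‖ ≤ M * Real.exp (c i * t))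
    (hc : Tendsto c F (𝓝 w)) (hD : Dense (A.domain : Set X))
    (hA : ∀ x : A.domain, Tendsto (fun i => B i x) F (𝓝 (A x))) :
    ∃ T : ℝ≥0 → X →L[ℝ] X, IsC0Semigroup T ∧
      (∀ (t : ℝ≥0) (x : X),
        Tendsto (fun i => NormedSpace.exp ((t : ℝ) • B i) x) F (𝓝 (T t x))) ∧
      (∀ t : ℝ≥0, ‖T t‖ ≤ M * Real.exp (w * t)) ∧ A ≤ semigroupGenerator T := by
  have hK := eventually_norm_exp_smul_le hM hb hc
  have hK' : ∀ t : ℝ≥0, ∀ᶠ i in F,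
      ‖NormedSpace.exp ((t : ℝ) • B i)‖ ≤ M * Real.exp ((|w| + 1) * t) := fun t => by
    filter_upwards [hK t] with i hi
    exact hi t ⟨t.coe_nonneg, le_rfl⟩
  have hlim : ∀ (t : ℝ≥0) (x : X), ∃ y,
      Tendsto (fun i => NormedSpace.exp ((t : ℝ) • B i) x) F (𝓝 y) := by
    intro t x
    refine CompleteSpace.complete (cauchy_map_apply_of_dense (hK' t) hD (fun x hx => ?_) x)
    set K := M * Real.exp ((|w| + 1) * t)
    have h1 : Tendsto (fun p : ι × ι => K * K * ‖B p.1 x - B p.2 x‖ * t) (F ×ˢ F) (𝓝 0) := by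
      have h2 := ((hA ⟨x, hx⟩).comp tendsto_fst).sub ((hA ⟨x, hx⟩).comp (tendsto_snd (f := F)))
      have h3 := ((h2.norm).const_mul (K * K)).mul_const (t : ℝ)
      simpa using h3
    refine squeeze_zero_norm' ?_ h1
    filter_upwards [(hK t).prod_mk (hK t)] with p hp
    exact norm_exp_smul_apply_sub_le (hcomm _ _) t.coe_nonneg hp.1 hp.2 x
  choose S hS using hlim
  let T : ℝ≥0 → X →L[ℝ] X := fun t =>
    continuousLinearMapOfTendsto (fun i => NormedSpace.exp ((t : ℝ) • B i))
      (tendsto_pi_nhds.2 (hS t))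
  have hT : ∀ (t : ℝ≥0) (x : X),
      Tendsto (fun i => NormedSpace.exp ((t : ℝ) • B i) x) F (𝓝 (T t x)) := hS
  have hTb : ∀ t : ℝ≥0, ‖T t‖ ≤ M * Real.exp (w * t) := by
    intro t
    refine ContinuousLinearMap.opNorm_le_bound _ (by positivity) fun x => ?_
    refine le_of_tendsto_of_tendsto' (hT t x).norm
      (((Real.continuous_exp.tendsto _).comp (hc.mul_const (t : ℝ))).const_mul M |>.mul_const ‖x‖)
      fun i => ?_
    exact ContinuousLinearMap.le_of_opNorm_le _ (hb i t t.coe_nonneg) x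
  have hTb' : ∀ (a : ℝ) (t : ℝ≥0), (t : ℝ) ≤ a → ‖T t‖ ≤ M * Real.exp (|w| * a) := by
    intro a t hta
    refine (hTb t).trans ?_
    gcongr
    exact le_abs_self w
  -- On the domain of `A` the orbits are locally Lipschitz.
  have hcontD : ∀ x ∈ A.domain, Continuous fun t => T t x := by
    intro x hx
    refine continuous_iff_continuousAt.2 fun t₀ => ?_
    set a : ℝ := t₀ + 1 with ha
    set K := M * Real.exp ((|w| + 1) * a)
    have hlip : ∀ s t : ℝ≥0, s ≤ t → (t : ℝ) ≤ a →
        ‖T t x - T s x‖ ≤ K * ‖A ⟨x, hx⟩‖ * (t - s) := by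
      intro s t hst hta
      refine le_of_tendsto_of_tendsto ((hT t x).sub (hT s x)).norm
        (((hA ⟨x, hx⟩).norm.const_mul K).mul_const ((t : ℝ) - s)) ?_
      filter_upwards [hK a] with i hi
      refine norm_image_sub_le_of_norm_deriv_le_segment'
        (f := fun s : ℝ => NormedSpace.exp (s • B i) x)
        (fun r _ => (hasDerivAt_exp_smul_apply (B i) x r).hasDerivWithinAt)
        (fun r hr => ?_) t ⟨NNReal.coe_le_coe.2 hst, le_rfl⟩
      exact ContinuousLinearMap.le_of_opNorm_le _
        (hi r ⟨s.coe_nonneg.trans hr.1, hr.2.le.trans hta⟩) _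
    have hbound : ∀ t : ℝ≥0, (t : ℝ) ≤ a →
        ‖T t x - T t₀ x‖ ≤ K * ‖A ⟨x, hx⟩‖ * |(t : ℝ) - t₀| := by
      intro t hta
      rcases le_total t₀ t with h | h
      · rw [abs_of_nonneg (sub_nonneg.2 (NNReal.coe_le_coe.2 h))]
        exact hlip t₀ t h hta
      · rw [abs_of_nonpos (sub_nonpos.2 (NNReal.coe_le_coe.2 h)), neg_sub, norm_sub_rev]
        exact hlip t t₀ h (by linarith)
    refine tendsto_iff_norm_sub_tendsto_zero.2 ?_
    have h0 : Tendsto (fun t : ℝ≥0 => K * ‖A ⟨x, hx⟩‖ * |(t : ℝ) - t₀|) (𝓝 t₀) (𝓝 0) := by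
      have : Continuous fun t : ℝ≥0 => K * ‖A ⟨x, hx⟩‖ * |(t : ℝ) - t₀| := by fun_prop
      exact this.tendsto' _ _ (by simp)
    refine squeeze_zero' (Eventually.of_forall fun _ => norm_nonneg _) ?_ h0
    have hev : ∀ᶠ t : ℝ≥0 in 𝓝 t₀, (t : ℝ) < a :=
      NNReal.continuous_coe.continuousAt.eventually_lt_const (by linarith)
    filter_upwards [hev] with t ht using hbound t ht.le
  have hcont : ∀ x, Continuous fun t => T t x := by
    intro x
    refine continuous_of_locally_uniform_approx_of_continuousAt fun t₀ u hu => ?_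
    obtain ⟨ε, hε, hεu⟩ := Metric.mem_uniformity_dist.1 hu
    set a : ℝ := t₀ + 1 with ha
    set K := M * Real.exp (|w| * a)
    have hK0 : 0 < K + 1 := by positivity
    obtain ⟨y, hy, hxy⟩ := hD.exists_dist_lt x (ε := ε / (K + 1)) (by positivity)
    have hev : ∀ᶠ t : ℝ≥0 in 𝓝 t₀, (t : ℝ) < a :=
      NNReal.continuous_coe.continuousAt.eventually_lt_const (by linarith)
    refine ⟨_, hev, fun t => T t y, (hcontD y hy).continuousAt, fun t ht => hεu ?_⟩
    rw [dist_eq_norm, ← map_sub]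
    rw [dist_eq_norm, lt_div_iff₀ hK0] at hxy
    have h1 := (T t).le_of_opNorm_le (hTb' a t (le_of_lt ht)) (x - y)
    have h2 : 0 ≤ ‖x - y‖ := norm_nonneg _
    linarith
  have hsg : IsC0Semigroup T := by
    refine ⟨?_, fun t s => ?_, hcont⟩
    · ext x
      refine tendsto_nhds_unique (hT 0 x) ?_
      simp
    · ext x
      refine tendsto_nhds_unique (hT (t + s) x) ?_
      refine (tendsto_apply_of_tendsto (hK' t) (hT s x) (hT t _)).congr fun i => ?_
      rw [NNReal.coe_add, exp_add_smul, mul_apply_eq_comp]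
  refine ⟨T, hsg, hT, hTb, ?_⟩
  -- Passing to the limit in `exp (t B i) x - x = ∫ s in 0..t, exp (s B i) (B i x)` gives
  -- `T t x - x = ∫ s in 0..t, T s (A x)` on the domain of `A`.
  have hgen : ∀ x : A.domain, ∃ h : (x : X) ∈ (semigroupGenerator T).domain,
      semigroupGenerator T ⟨x, h⟩ = A x := by
    intro x
    have hc0 := hsg.continuous_toNNReal (A x)
    have hint : ∀ t : ℝ≥0, T t x = x + ∫ s in (0 : ℝ)..t, T s.toNNReal (A x) := by
      intro t
      have h1 : Tendsto (fun i => ∫ s in (0 : ℝ)..t, NormedSpace.exp (s • B i) (B i x)) F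
          (𝓝 (∫ s in (0 : ℝ)..t, T s.toNNReal (A x))) := by
        refine intervalIntegral.tendsto_integral_filter_of_dominated_convergence
          (fun _ => M * Real.exp ((|w| + 1) * t) * (‖A x‖ + 1)) ?_ ?_ (by simp) ?_
        · refine Eventually.of_forall fun i => Continuous.aestronglyMeasurable ?_
          exact continuous_iff_continuousAt.2 fun s =>
            (hasDerivAt_exp_smul_apply (B i) (B i x) s).continuousAt
        · filter_upwards [hK t, (hA x).norm.eventually_le_const (lt_add_one _)] with i hi hi'
          refine ae_of_all _ fun s hs => ?_
          rw [Set.uIoc_of_le t.coe_nonneg] at hs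
          exact ContinuousLinearMap.le_of_opNorm_le_of_le _ (hi s ⟨hs.1.le, hs.2⟩) hi'
        · refine ae_of_all _ fun s hs => ?_
          rw [Set.uIoc_of_le t.coe_nonneg] at hs
          have := tendsto_apply_of_tendsto (hK' s.toNNReal) (hA x) (hT s.toNNReal _)
          rwa [Real.coe_toNNReal _ hs.1.le] at this
      have h2 : Tendsto (fun i => ∫ s in (0 : ℝ)..t, NormedSpace.exp (s • B i) (B i x)) F
          (𝓝 (T t x - x)) := by
        refine ((hT t x).sub_const (x : X)).congr fun i => ?_
        rw [intervalIntegral.integral_eq_sub_of_hasDerivAt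
          (fun s _ => hasDerivAt_exp_smul_apply (B i) x s)]
        · simp
        · refine Continuous.intervalIntegrable ?_ _ _
          exact continuous_iff_continuousAt.2 fun s =>
            (hasDerivAt_exp_smul_apply (B i) (B i x) s).continuousAt
      rw [tendsto_nhds_unique h1 h2, add_sub_cancel]
    have hder := ((hc0.integral_hasStrictDerivAt 0 0).hasDerivAt).const_add (x : X)
    have e : T (Real.toNNReal 0) (A x) = A x := by rw [Real.toNNReal_zero, hsg.map_zero]; rfl
    rw [e] at hder
    exact mem_semigroupGenerator_of_tendsto
      (tendsto_diffQuot_of_hasDerivAt hder (by simp) hint)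
  refine ⟨fun x hx => (hgen ⟨x, hx⟩).1, fun x y hxy => ?_⟩
  obtain ⟨h, h'⟩ := hgen x
  rw [← h']
  congr 1
  exact Subtype.ext hxy

end Approximation

/-! ### The Yosida approximation -/

section Yosida

variable {X ι : Type*} [NormedAddCommGroup X] [NormedSpace ℝ X]
  {F : Filter ι} {R : ι → X →L[ℝ] X} {r : ι → ℝ} {M w : ℝ} {A : X →ₗ.[ℝ] X}

theorem tendsto_smul_resolvent_apply (hr : Tendsto r F atTop)
    (hrw : ∀ i, w < r i) (hR : ∀ i, IsResolventAt A (r i) (R i))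
    (hb : ∀ i, ‖R i‖ ≤ M / (r i - w)) (hD : Dense (A.domain : Set X)) (x : X) :
    Tendsto (fun i => r i • R i x) F (𝓝 x) := by
  have hzero : Tendsto (fun i => M / (r i - w)) F (𝓝 0) :=
    (tendsto_atTop_add_const_right F (-w) hr).const_div_atTop M
  have hbd : Tendsto (fun i => M / (r i - w) * r i + 1) F (𝓝 (M + 1)) := by
    have h1 : Tendsto (fun i => M + M / (r i - w) * w + 1) F (𝓝 (M + 0 * w + 1)) :=
      ((hzero.mul_const w).const_add M).add_const 1
    rw [zero_mul, add_zero] at h1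
    refine h1.congr fun i => ?_
    have : r i - w ≠ 0 := (sub_pos.2 (hrw i)).ne'
    field_simp
    ring
  have h1 : Tendsto (fun i => (r i • R i - 1) x) F (𝓝 0) := by
    refine tendsto_apply_zero_of_dense (K := M + 1 + 1) ?_ hD (fun y hy => ?_) x
    · filter_upwards [hbd.eventually_le_const (lt_add_one _), hr.eventually_ge_atTop 0]
        with i hi hi0
      refine ((norm_sub_le _ _).trans (add_le_add ?_ ContinuousLinearMap.norm_id_le)).trans hi
      rw [norm_smul, Real.norm_of_nonneg hi0, mul_comm]
      exact mul_le_mul_of_nonneg_right (hb i) hi0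
    · have h2 := hzero.mul_const ‖A ⟨y, hy⟩‖
      rw [zero_mul] at h2
      refine squeeze_zero_norm (fun i => ?_) h2
      have e : (r i • R i - 1) y = R i (A ⟨y, hy⟩) := by
        rw [(hR i).apply_comm, (hR i).apply_eq]; rfl
      rw [e]
      exact (R i).le_of_opNorm_le (hb i) _
  have h2 := h1.add_const x
  rw [zero_add] at h2
  refine h2.congr fun i => ?_
  simp

/-- The Hille–Yosida–Phillips generation theorem: the approximations `r (r R - 1) = r A R`
converge to `A` on its domain, and the semigroup obtained from them has generator `A` because
the generator is an extension of `A` with a common resolvent point. -/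
theorem exists_isC0Semigroup_of_resolvent [CompleteSpace X] [F.NeBot] [F.IsCountablyGenerated]
    (hr : Tendsto r F atTop) (hrw : ∀ i, w < r i) (hR : ∀ i, IsResolventAt A (r i) (R i))
    (hb : ∀ i (k : ℕ), ‖R i ^ k‖ ≤ M / (r i - w) ^ k) (hM : 0 ≤ M)
    (hD : Dense (A.domain : Set X)) :
    ∃ T : ℝ≥0 → X →L[ℝ] X, IsC0Semigroup T ∧
      (∀ (t : ℝ≥0) (x : X),
        Tendsto (fun i => NormedSpace.exp ((t : ℝ) • (r i • (r i • R i - 1))) x) F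
          (𝓝 (T t x))) ∧
      (∀ t : ℝ≥0, ‖T t‖ ≤ M * Real.exp (w * t)) ∧ semigroupGenerator T = A := by
  have hc : Tendsto (fun i => r i * w / (r i - w)) F (𝓝 w) := by
    have hzero : Tendsto (fun i => w ^ 2 / (r i - w)) F (𝓝 0) :=
      (tendsto_atTop_add_const_right F (-w) hr).const_div_atTop _
    have h1 := hzero.const_add w
    rw [add_zero] at h1
    refine h1.congr fun i => ?_
    have : r i - w ≠ 0 := (sub_pos.2 (hrw i)).ne'
    field_simp
    ring
  have hcomm : ∀ i j, Commute (r i • (r i • R i - 1)) (r j • (r j • R j - 1)) := by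
    intro i j
    have h : Commute (r i • R i) (r j • R j) :=
      (((hR i).commute (hR j)).smul_left (r i)).smul_right (r j)
    exact (((h.sub_left (Commute.one_left _)).sub_right
      ((Commute.one_right _).sub_left (Commute.one_left _))).smul_left (r i)).smul_right (r j)
  have hexp : ∀ i, ∀ t : ℝ, 0 ≤ t → ‖NormedSpace.exp (t • (r i • (r i • R i - 1)))‖ ≤
      M * Real.exp (r i * w / (r i - w) * t) := by
    intro i t ht
    rw [exp_smul_smul_smul_sub_one, norm_smul, Real.norm_of_nonneg (Real.exp_pos _).le]
    refine (mul_le_mul_of_nonneg_left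
      (norm_exp_smul_le_of_norm_pow_le (by positivity) (hb i)) (Real.exp_pos _).le).trans_eq ?_
    rw [mul_left_comm, ← Real.exp_add]
    have : r i - w ≠ 0 := (sub_pos.2 (hrw i)).ne'
    congr 2
    field_simp
    ring
  have hconv : ∀ x : A.domain,
      Tendsto (fun i => (r i • (r i • R i - 1) : X →L[ℝ] X) x) F (𝓝 (A x)) := by
    intro x
    refine (tendsto_smul_resolvent_apply (M := M) hr hrw hR (fun i => ?_) hD (A x)).congr
      fun i => ?_
    · simpa using hb i 1
    · rw [(hR i).apply_comm, (hR i).apply_eq]; rfl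
  obtain ⟨T, hT, hlim, hTb, hle⟩ := exists_isC0Semigroup_of_tendsto hM hcomm hexp hc hD hconv
  refine ⟨T, hT, hlim, hTb, ?_⟩
  obtain ⟨i⟩ : Nonempty ι := F.nonempty_of_neBot
  obtain ⟨S, hS⟩ := hT.exists_isLaplaceTransformAt hTb (hrw i)
  exact ((hR i).eq_of_le (hS.isResolventAt hT) hle).symm

end Yosida

/-! ### Right linearity of limits, and the conclusion -/

section Conclusion

variable {𝔸 X : Type*} [NonAssocRing 𝔸] [Module ℝ 𝔸] [StarRing 𝔸] [Norm 𝔸]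
  [NormedAddCommGroup X] [NormedSpace ℝ X] [SMul 𝔸 X] [SMul 𝔸ᵐᵒᵖ X] [NormedAltBimodule 𝔸 X]

theorem IsRightLinear.of_tendsto {ι : Type*} {F : Filter ι} [F.NeBot] {E : ι → X →L[ℝ] X}
    {S : X →L[ℝ] X} (hE : ∀ i, IsRightLinear 𝔸 (E i))
    (h : ∀ x, Tendsto (fun i => E i x) F (𝓝 (S x))) : IsRightLinear 𝔸 S := by
  intro x a
  refine tendsto_nhds_unique (h (x <• a)) ?_
  exact (((rightMulOp X a).continuous.tendsto _).comp (h x)).congr fun i => (hE i x a).symm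

theorem IsRightLinear.exp_smul {B : X →L[ℝ] X} (hB : IsRightLinear 𝔸 B) (t : ℝ) :
    IsRightLinear 𝔸 (NormedSpace.exp (t • B)) :=
  isRightLinear_iff_commute.2 fun a => ((isRightLinear_iff_commute.1 hB a).smul_left t).exp_left

theorem isRightLinearPMap_semigroupGenerator {T : ℝ≥0 → X →L[ℝ] X}
    (hT : ∀ t, IsRightLinear 𝔸 (T t)) : IsRightLinearPMap 𝔸 (semigroupGenerator T) := fun x a =>
  map_mem_semigroupGenerator (C := rightMulOp X a)
    (fun t => (isRightLinear_iff_commute.1 (hT t) a).symm) x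

theorem yosidaApprox_eq [AlternativeStarAlgebra 𝔸] [CompleteSpace X] (A : X →ₗ.[ℝ] X)
    (hA : A.IsClosed) {n : ℝ} (hn : n • (1 : 𝔸) ∈ sphericalResolventSet 𝔸 A) :
    yosidaApprox A hA hn = n • (n • sphericalResolvent A hA hn - 1) := by
  rw [yosidaApprox]
  congr 1
  ext x
  rw [closedComp_apply, (isResolventAt_sphericalResolvent A hA hn).apply_eq]
  rfl

end Conclusion

theorem theoremT {𝔸 X : Type*} [NonAssocRing 𝔸] [Module ℝ 𝔸] [StarRing 𝔸] [Norm 𝔸]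
    [AlternativeStarAlgebra 𝔸] [NormedAddCommGroup X] [NormedSpace ℝ X] [CompleteSpace X]
    [SMul 𝔸 X] [SMul 𝔸ᵐᵒᵖ X] [NormedAltBimodule 𝔸 X] :
    (∀ (A : X →ₗ.[ℝ] X) (hA : A.IsClosed), IsRightLinearPMap 𝔸 A → Dense (A.domain : Set X) →
      ∀ (M w : ℝ), 1 ≤ M →
      ∀ hρ : ∀ l : ℝ, w < l → l • (1 : 𝔸) ∈ sphericalResolventSet 𝔸 A,
      (∀ (n : ℕ) (l : ℝ) (hl : w < l),
        ‖sphericalResolvent A hA (hρ l hl) ^ n‖ ≤ M / (l - w) ^ n) →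
      (∀ (n : ℕ) (hn : w < n), IsRightLinear 𝔸 (yosidaApprox A hA (hρ n hn))) ∧
      ∃ T : ℝ≥0 → X →L[ℝ] X, IsRightC0Semigroup 𝔸 T ∧ semigroupGenerator T = A ∧
        (∀ (t : ℝ≥0) (x : X),
          Tendsto (fun n : {n : ℕ // w < n} =>
            NormedSpace.exp ((t : ℝ) • yosidaApprox A hA (hρ n n.2)) x) atTop (𝓝 (T t x))) ∧
        (∀ t : ℝ≥0, ‖T t‖ ≤ M * Real.exp (w * t)) ∧
        ∀ (l : ℝ) (hl : w < l), IsLaplaceTransformAt T l (sphericalResolvent A hA (hρ l hl))) ∧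
    (∀ T : ℝ≥0 → X →L[ℝ] X, IsRightC0Semigroup 𝔸 T →
      (∃ M w : ℝ, 1 < M ∧ ∀ t : ℝ≥0, ‖T t‖ ≤ M * Real.exp (w * t)) ∧
      IsRightLinearPMap 𝔸 (semigroupGenerator T) ∧
      Dense ((semigroupGenerator T).domain : Set X) ∧
      ∃ hA : (semigroupGenerator T).IsClosed,
        ∀ M w : ℝ, 1 ≤ M → (∀ t : ℝ≥0, ‖T t‖ ≤ M * Real.exp (w * t)) →
        ∃ hρ : ∀ l : ℝ, w < l → l • (1 : 𝔸) ∈ sphericalResolventSet 𝔸 (semigroupGenerator T),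
          (∀ (n : ℕ) (l : ℝ) (hl : w < l),
            ‖sphericalResolvent (semigroupGenerator T) hA (hρ l hl) ^ n‖ ≤ M / (l - w) ^ n) ∧
          ∀ (l : ℝ) (hl : w < l),
            IsLaplaceTransformAt T l
              (sphericalResolvent (semigroupGenerator T) hA (hρ l hl))) := by
  refine ⟨fun A hA hAr hD M w hM hρ hb => ?_, fun T hT => ?_⟩
  · have hyr : ∀ (n : ℕ) (hn : w < n), IsRightLinear 𝔸 (yosidaApprox A hA (hρ n hn)) := by
      intro n hn
      rw [yosidaApprox_eq, isRightLinear_iff_commute]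
      intro a
      have h := isRightLinear_iff_commute.1
        ((isResolventAt_sphericalResolvent A hA (hρ n hn)).isRightLinear hAr) a
      exact ((h.smul_left (n : ℝ)).sub_left (Commute.one_left _)).smul_left (n : ℝ)
    refine ⟨hyr, ?_⟩
    obtain ⟨n₀, hn₀⟩ := exists_nat_gt w
    have : Nonempty {n : ℕ // w < n} := ⟨⟨n₀, hn₀⟩⟩
    have : IsDirectedOrder {n : ℕ // w < n} :=
      ⟨fun a b => (le_total a b).elim (fun h => ⟨b, h, le_rfl⟩) fun h => ⟨a, le_rfl, h⟩⟩
    have hr : Tendsto (fun n : {n : ℕ // w < n} => ((n : ℕ) : ℝ)) atTop atTop := by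
      refine tendsto_atTop.2 fun c => ?_
      obtain ⟨m, hm⟩ := exists_nat_gt (max c w)
      filter_upwards [eventually_ge_atTop
        (⟨m, (le_max_right _ _).trans_lt hm⟩ : {n : ℕ // w < n})] with n hn
      have hmn : (m : ℝ) ≤ (n : ℕ) := Nat.cast_le.2 hn
      exact (le_max_left c w).trans (hm.le.trans hmn)
    obtain ⟨T, hT, hlim, hTb, hgen⟩ := exists_isC0Semigroup_of_resolvent
      (r := fun n : {n : ℕ // w < n} => ((n : ℕ) : ℝ))
      (R := fun n : {n : ℕ // w < n} => sphericalResolvent A hA (hρ n n.2)) hr (fun n => n.2)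
      (fun n : {n : ℕ // w < n} => isResolventAt_sphericalResolvent A hA (hρ n n.2))
      (fun n k => hb k (n : ℕ) n.2)
      (zero_le_one.trans hM) hD
    have hlim' : ∀ (t : ℝ≥0) (x : X), Tendsto (fun n : {n : ℕ // w < n} =>
        NormedSpace.exp ((t : ℝ) • yosidaApprox A hA (hρ n n.2)) x) atTop (𝓝 (T t x)) :=
      fun t x => (hlim t x).congr fun n => by rw [yosidaApprox_eq]
    refine ⟨T, ⟨fun t => ?_, fun t s _ _ => hT.map_add t s, hT.map_zero,
      hT.strongly_continuous⟩, hgen, hlim', hTb, fun l hl => ?_⟩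
    · exact IsRightLinear.of_tendsto (fun n : {n : ℕ // w < n} => (hyr n n.2).exp_smul t) (hlim' t)
    · obtain ⟨S, hS⟩ := hT.exists_isLaplaceTransformAt hTb hl
      have hSr := hS.isResolventAt hT
      rw [hgen] at hSr
      rwa [(isResolventAt_sphericalResolvent A hA (hρ l hl)).unique hSr]
  · have hTc := hT.isC0Semigroup
    have hr := isRightLinearPMap_semigroupGenerator hT.right_linear
    have hbd := hTc.exists_norm_le
    refine ⟨hbd, hr, hTc.dense_domain, ?_⟩
    obtain ⟨M₀, w₀, -, hb₀⟩ := hbd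
    obtain ⟨S, hS⟩ := hTc.exists_isLaplaceTransformAt hb₀ (lt_add_one w₀)
    refine ⟨(hS.isResolventAt hTc).isClosed, fun M w hM hb => ?_⟩
    have hex : ∀ l : ℝ, w < l → ∃ R : X →L[ℝ] X, IsLaplaceTransformAt T l R := fun l hl =>
      hTc.exists_isLaplaceTransformAt hb hl
    have hρ : ∀ l : ℝ, w < l → l • (1 : 𝔸) ∈ sphericalResolventSet 𝔸 (semigroupGenerator T) := by
      intro l hl
      obtain ⟨R, hR⟩ := hex l hl
      have hres := hR.isResolventAt hTc
      exact hres.mem_sphericalResolventSet (hres.isRightLinear hr)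
    have hlap : ∀ (l : ℝ) (hl : w < l), IsLaplaceTransformAt T l (sphericalResolvent
        (semigroupGenerator T) (hS.isResolventAt hTc).isClosed (hρ l hl)) := by
      intro l hl
      obtain ⟨R, hR⟩ := hex l hl
      rwa [(isResolventAt_sphericalResolvent _ _ (hρ l hl)).unique (hR.isResolventAt hTc)]
    exact ⟨hρ, fun n l hl => (hlap l hl).norm_pow_le hTc (zero_le_one.trans hM) hb hl n, hlap⟩
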